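/- A group is called *minimal non-nilpotent* if it is not nilpotent but all of its proper subgroups are nilpotent. A group $G$ is called *para-$\mathfrak{Nil}$-Hamiltonian* if $G$ is not nilpotent and every non-normal subgroup of $G$ is either nilpotent or minimal non-nilpotent. A group is called *locally graded* if each of its non-trivial finitely generated subgroups contains a proper subgroup of finite index. Theorem 4.6. Let $G$ be a para-$\mathfrak{Nil}$-Hamiltonian group, and let $X$ be a finitely generated minimal non-nilpotent subgroup of $G$ whose normal closure $X^G$ in $G$ is locally graded. Then the commutator subgroup $G'$ is finite. Furthermore, if $X$ is normal in $G$ or $G$ is infinite, then $G$ is soluble. -/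

import Mathlib

universe u

/-- A group is minimal non-nilpotent if it is not nilpotent but all its proper subgroups are. -/
def IsMinimalNonNilpotent (G : Type u) [Group G] : Prop :=
  ¬ Group.IsNilpotent G ∧ ∀ H : Subgroup G, H ≠ ⊤ → Group.IsNilpotent H

/-- A group is para-Nil-Hamiltonian if it is not nilpotent and every non-normal subgroup of it is
either nilpotent or minimal non-nilpotent. -/
def IsParaNilHamiltonian (G : Type u) [Group G] : Prop :=
  ¬ Group.IsNilpotent G ∧
    ∀ H : Subgroup G, ¬ H.Normal → Group.IsNilpotent H ∨ IsMinimalNonNilpotent H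

/-- A group is locally graded if every non-trivial finitely generated subgroup of it contains a
proper subgroup of finite index. -/
def IsLocallyGraded (G : Type u) [Group G] : Prop :=
  ∀ H : Subgroup G, H ≠ ⊥ → H.FG → ∃ K : Subgroup H, K ≠ ⊤ ∧ K.FiniteIndex

/-!
Let `M` be the normal closure of `X`. A subgroup `H` properly containing `X` is neither nilpotent
nor minimal non-nilpotent, since `X` is a proper non-nilpotent subgroup of it; so `H` is normal, and
in particular contains `M`. Consequently every subgroup of `G ⧸ M` is normal, i.e. `G ⧸ M` is a
Dedekind group. The proof shows that `X`, then `M`, then the commutator subgroup of `G ⧸ M` are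
finite.

* `X` is finite. Being locally graded, it has a proper normal subgroup of finite index, which is
  nilpotent, and by Schmidt's theorem (`isSolvable_of_proper_isNilpotent`) `X` is soluble. By
  Fitting's theorem (`Subgroup.isNilpotent_of_sup_eq_top`) `X / X'` is generated by a single element
  `t` and is finite. On `B = X' / X''` the map `b ↦ ⁅t, b⁆` is surjective, hence injective, `B` being
  a finitely generated abelian group. So a proper subgroup containing `t`, which is nilpotent, meets
  `B` trivially; applied to `⟨t⟩ B²` this forces `B` to be finite. Then the nilpotent group `X'` has
  finite abelianization, hence is finite.
* `M` is finite. The finite group `X` is maximal in `M` (or equal to it), so if `M` were infinite,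
  each normal subgroup of finite index would supplement `X` and have index at most `|X|`; but in a
  finitely generated infinite locally graded group these indices are unbounded
  (`finite_of_locallyGraded_of_finite_subgroup`).
* The centre of a Dedekind group has finite index (`finiteIndex_center_of_forall_normal`), so its
  commutator subgroup is finite by Schur's theorem, and it has class at most two.

For solubility it remains to treat `M`. If `X` is normal, then `M = X`. If `G` is infinite, then so
is the centralizer of the finite group `M`; the product of `X` with it exceeds `X`, so contains `M`,
and `M` modulo its centre is an image of the soluble group `X`.
-/

open scoped commutatorElement

/-! ### Fitting's theorem and nilpotent groups with finite abelianization -/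

namespace Subgroup

variable {G : Type*} [Group G]

theorem commutator_le_iff_le_comap_centralizer {H₁ H₂ K : Subgroup G} [K.Normal] :
    ⁅H₁, H₂⁆ ≤ K ↔
      H₁ ≤ (centralizer (H₂.map (QuotientGroup.mk' K) : Set (G ⧸ K))).comap
        (QuotientGroup.mk' K) := by
  rw [← map_le_iff_le_comap, ← commutator_eq_bot_iff_le_centralizer, ← map_commutator,
    map_eq_bot_iff, QuotientGroup.ker_mk']

theorem sup_commutator_le_iff {H₁ H₂ H₃ K : Subgroup G} [K.Normal] :
    ⁅H₁ ⊔ H₂, H₃⁆ ≤ K ↔ ⁅H₁, H₃⁆ ≤ K ∧ ⁅H₂, H₃⁆ ≤ K := by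
  simp only [commutator_le_iff_le_comap_centralizer, sup_le_iff]

theorem iSup_commutator_le_iff {ι : Sort*} {H : ι → Subgroup G} {H₃ K : Subgroup G} [K.Normal] :
    ⁅⨆ i, H i, H₃⁆ ≤ K ↔ ∀ i, ⁅H i, H₃⁆ ≤ K := by
  simp only [commutator_le_iff_le_comap_centralizer, iSup_le_iff]

/-- The lower central series of `S` shifted by one, so that it starts at the whole group. For `S`
normal, commutators of weight `i` in `S` lie in the `i`-th term. -/
def shiftedLowerCentralSeries (S : Subgroup G) : ℕ → Subgroup G
  | 0 => ⊤
  | n + 1 => S.lowerCentralSeries n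

theorem shiftedLowerCentralSeries_commutator_le (S : Subgroup G) [S.Normal] (n : ℕ) :
    ⁅S.shiftedLowerCentralSeries n, S⁆ ≤ S.shiftedLowerCentralSeries (n + 1) := by
  cases n with
  | zero => exact commutator_le_right _ _
  | succ n => exact le_rfl

instance shiftedLowerCentralSeries_normal (S : Subgroup G) [S.Normal] (n : ℕ) :
    (S.shiftedLowerCentralSeries n).Normal := by
  cases n with
  | zero => exact inferInstanceAs (⊤ : Subgroup G).Normal
  | succ n => exact inferInstanceAs (S.lowerCentralSeries n).Normal

theorem exists_shiftedLowerCentralSeries_eq_bot (S : Subgroup G) [Group.IsNilpotent S] :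
    ∃ c, ∀ n, c ≤ n → S.shiftedLowerCentralSeries n = ⊥ := by
  obtain ⟨c, hc⟩ := (isNilpotent_iff_lowerCentralSeries (S := S)).1 inferInstance
  refine ⟨c + 1, fun n hn => ?_⟩
  obtain ⟨m, rfl⟩ : ∃ m, n = m + 1 := ⟨n - 1, by omega⟩
  exact eq_bot_iff.2 (hc ▸ S.lowerCentralSeries_antitone (by omega))

/-- **Fitting's theorem**: a product of two normal nilpotent subgroups is nilpotent. A commutator of
weight `n` in elements of `A ∪ B` has weight `i` in `A` and `n - i` in `B` for some `i`, so it lies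
in the intersection of the corresponding terms of the two lower central series. -/
theorem isNilpotent_of_sup_eq_top (A B : Subgroup G) [A.Normal] [B.Normal]
    [Group.IsNilpotent A] [Group.IsNilpotent B] (h : A ⊔ B = ⊤) : Group.IsNilpotent G := by
  let F : ℕ → Subgroup G := fun n => ⨆ p : {p : ℕ × ℕ // p.1 + p.2 = n},
    A.shiftedLowerCentralSeries p.1.1 ⊓ B.shiftedLowerCentralSeries p.1.2
  have le_F : ∀ n i j, i + j = n →
      A.shiftedLowerCentralSeries i ⊓ B.shiftedLowerCentralSeries j ≤ F n := fun n i j hij =>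
    le_iSup (fun p : {p : ℕ × ℕ // p.1 + p.2 = n} =>
      A.shiftedLowerCentralSeries p.1.1 ⊓ B.shiftedLowerCentralSeries p.1.2) ⟨(i, j), hij⟩
  have F_normal : ∀ n, (F n).Normal := fun n => inferInstance
  have step : ∀ n, ⁅F n, (⊤ : Subgroup G)⁆ ≤ F (n + 1) := by
    intro n
    rw [iSup_commutator_le_iff]
    rintro ⟨⟨i, j⟩, hij⟩
    rw [commutator_comm, ← h, sup_commutator_le_iff]
    constructor
    · refine le_trans (le_inf ?_ ?_) (le_F (n + 1) (i + 1) j (by simp at hij; omega))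
      · rw [commutator_comm]
        exact (commutator_mono inf_le_left le_rfl).trans
          (A.shiftedLowerCentralSeries_commutator_le i)
      · exact (commutator_mono le_rfl inf_le_right).trans (commutator_le_right _ _)
    · refine le_trans (le_inf ?_ ?_) (le_F (n + 1) i (j + 1) (by simp at hij; omega))
      · exact (commutator_mono le_rfl inf_le_left).trans (commutator_le_right _ _)
      · rw [commutator_comm]
        exact (commutator_mono inf_le_right le_rfl).trans
          (B.shiftedLowerCentralSeries_commutator_le j)
  have lcs_le : ∀ n, (⊤ : Subgroup G).lowerCentralSeries n ≤ F n := by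
    intro n
    induction n with
    | zero => exact le_trans (le_inf le_top le_top) (le_F 0 0 0 rfl)
    | succ n ih => exact (commutator_mono ih le_rfl).trans (step n)
  obtain ⟨a, ha⟩ := A.exists_shiftedLowerCentralSeries_eq_bot
  obtain ⟨b, hb⟩ := B.exists_shiftedLowerCentralSeries_eq_bot
  rw [nilpotent_iff_lowerCentralSeries]
  refine ⟨a + b, eq_bot_iff.2 ((lcs_le _).trans (iSup_le ?_))⟩
  rintro ⟨⟨i, j⟩, hij⟩
  simp only at hij ⊢
  rcases le_or_gt a i with hi | hi
  · rw [ha i hi, bot_inf_eq]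
  · rw [hb j (by omega), inf_bot_eq]

end Subgroup

/-- A commutator `⁅a, b⁆` depends only on the cosets of `a` and `b` modulo the centre. -/
theorem finite_commutatorSet_of_finiteIndex_center (G : Type*) [Group G]
    [(Subgroup.center G).FiniteIndex] : Finite (commutatorSet G) := by
  let f : (G ⧸ Subgroup.center G) × (G ⧸ Subgroup.center G) → G := fun p => ⁅p.1.out, p.2.out⁆
  refine ((Set.finite_range f).subset ?_).to_subtype
  rintro _ ⟨a, b, rfl⟩
  refine ⟨(QuotientGroup.mk a, QuotientGroup.mk b), ?_⟩
  obtain ⟨y, hy⟩ := QuotientGroup.mk_out_eq_mul (Subgroup.center G) a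
  obtain ⟨z, hz⟩ := QuotientGroup.mk_out_eq_mul (Subgroup.center G) b
  have hyc := Subgroup.mem_center_iff.1 y.2
  have hzc := Subgroup.mem_center_iff.1 z.2
  have key : ∀ g z' : G, (∀ x, x * z' = z' * x) → ∀ h : G, ⁅g * z', h⁆ = ⁅g, h⁆ := by
    intro g z' hz' h
    rw [commutatorElement_def, commutatorElement_def, mul_inv_rev, mul_assoc g, ← hz' h]
    group
  simp only [f, hy, hz]
  rw [key a _ hyc, ← commutatorElement_inv, key b _ hzc, commutatorElement_inv]

/-- By induction on the nilpotency class `G / Z(G)` is finite, whence `G'` is finite by Schur. -/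
theorem Group.IsNilpotent.finite_of_finiteIndex_commutator (G : Type*) [Group G]
    [Group.IsNilpotent G] (h : (commutator G).FiniteIndex) : Finite G := by
  revert h
  refine nilpotent_center_quotient_ind (P := fun G _ _ => (commutator G).FiniteIndex → Finite G) G
    ?_ ?_
  · intro G _ _ _
    exact Finite.of_subsingleton
  · intro G _ _ ih h
    let f := QuotientGroup.mk' (Subgroup.center G)
    have hf : Function.Surjective f := QuotientGroup.mk'_surjective _
    have h1 : (commutator (G ⧸ Subgroup.center G)).FiniteIndex := by
      have : commutator (G ⧸ Subgroup.center G) = (commutator G).map f := by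
        rw [commutator_def, commutator_def, Subgroup.map_commutator,
          Subgroup.map_top_of_surjective f hf]
      rw [this, Subgroup.finiteIndex_iff]
      exact ne_zero_of_dvd_ne_zero h.index_ne_zero (Subgroup.index_map_dvd _ hf)
    have := ih h1
    have : (Subgroup.center G).FiniteIndex := Subgroup.finiteIndex_of_finite_quotient
    have := finite_commutatorSet_of_finiteIndex_center G
    exact (Subgroup.finite_iff_finite_and_finiteIndex (commutator G)).2 ⟨inferInstance, h⟩

/-! ### Schmidt's theorem -/

theorem isNilpotent_proper_of_surjective {G Q : Type*} [Group G] [Group Q]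
    (hG : ∀ H : Subgroup G, H ≠ ⊤ → Group.IsNilpotent H) (f : G →* Q)
    (hf : Function.Surjective f) (K : Subgroup Q) (hK : K ≠ ⊤) : Group.IsNilpotent K := by
  have : Group.IsNilpotent (K.comap f) := hG _ fun h => hK <| by
    rw [← Subgroup.map_comap_eq_self_of_surjective hf K, h, Subgroup.map_top_of_surjective f hf]
  exact Group.nilpotent_of_surjective (f.subgroupComap K)
    (f.subgroupComap_surjective_of_surjective K hf)

namespace Subgroup

variable {G : Type*} [Group G]

theorem exists_mem_normalizer_of_lt_of_isNilpotent {D H : Subgroup G} [Group.IsNilpotent H]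
    (h : D < H) : ∃ x ∈ H, x ∉ D ∧ x ∈ normalizer (D : Set G) := by
  have hlt : D.subgroupOf H < ⊤ := lt_top_iff_ne_top.2 fun h' => h.not_ge (subgroupOf_eq_top.1 h')
  obtain ⟨x, hx, hxD⟩ := SetLike.exists_of_lt
    (Group.normalizerCondition_of_isNilpotent (G := H) (D.subgroupOf H) hlt)
  refine ⟨x, x.2, hxD, mem_normalizer_iff.2 fun g => ⟨fun hg => ?_, fun hg => ?_⟩⟩
  · exact (mem_normalizer_iff.1 hx ⟨g, h.le hg⟩).1 hg
  · have hgH : g ∈ H := by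
      have := H.mul_mem (H.mul_mem (H.inv_mem x.2) (h.le hg)) x.2
      simpa [mul_assoc] using this
    exact (mem_normalizer_iff.1 hx ⟨g, hgH⟩).2 hg

theorem mem_of_map_conj_eq_of_isCoatom [IsSimpleGroup G] {M : Subgroup G} (hM : IsCoatom M)
    (hbot : M ≠ ⊥) {g : G} (hg : M.map (MulAut.conj g : G →* G) = M) : g ∈ M := by
  have hN : normalizer (M : Set G) ≠ ⊤ := fun h =>
    (IsSimpleGroup.eq_bot_or_eq_top_of_normal M (normalizer_eq_top_iff.1 h)).elim hbot hM.1
  have hNM : normalizer (M : Set G) = M :=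
    (hM.le_iff.1 le_normalizer).resolve_left hN
  rw [← hNM, mem_normalizer_iff]
  intro h
  constructor
  · intro hh
    rw [← hg]
    exact ⟨h, hh, rfl⟩
  · intro hh
    rw [← hg] at hh
    obtain ⟨y, hy, hyh⟩ := hh
    have : y = h := by simpa using hyh
    exact this ▸ hy

/-- The conjugates of the non-identity elements of `M`, parametrized by the cosets of `M`. -/
noncomputable def conjOfCoset (M : Subgroup G) (p : (G ⧸ M) × {m : M // m ≠ 1}) :
    {g : G // g ≠ 1} :=
  ⟨p.1.out * p.2.1 * p.1.out⁻¹, fun h => p.2.2 (by simpa using h)⟩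

variable [Finite G]

/-- If `D = M₁ ⊓ M₂ ≠ ⊥` is a largest non-trivial intersection, then by the normalizer condition in
`M₁` and `M₂` a maximal subgroup containing the normalizer of `D` meets both in more than `D`. -/
theorem inf_eq_bot_of_isCoatom [IsSimpleGroup G]
    (hG : ∀ H : Subgroup G, H ≠ ⊤ → Group.IsNilpotent H) {M₁ M₂ : Subgroup G}
    (h₁ : IsCoatom M₁) (h₂ : IsCoatom M₂) (hne : M₁ ≠ M₂) : M₁ ⊓ M₂ = ⊥ := by
  obtain ⟨D, hD⟩ : ∃ D, M₁ ⊓ M₂ = D := ⟨_, rfl⟩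
  rw [hD]
  induction D using WellFoundedGT.induction generalizing M₁ M₂ with
  | ind D ih =>
    by_contra hbot
    have hDtop : D ≠ ⊤ := fun h => h₁.1 (top_le_iff.1 (h ▸ hD ▸ inf_le_left))
    have hN : normalizer (D : Set G) ≠ ⊤ := fun h =>
      (IsSimpleGroup.eq_bot_or_eq_top_of_normal D (normalizer_eq_top_iff.1 h)).elim hbot hDtop
    obtain ⟨M₃, h₃, hle⟩ := (eq_top_or_exists_le_coatom _).resolve_left hN
    have key : ∀ {M M' : Subgroup G}, IsCoatom M → IsCoatom M' → M ≠ M' → M ⊓ M' = D →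
        M = M₃ := by
      intro M M' hM hM' hMM' hinf
      by_contra hM3
      have hlt : D < M := lt_of_le_of_ne (hinf ▸ inf_le_left) fun h => hMM' <| by
        have hle' : M ≤ M' := h ▸ hinf ▸ inf_le_right
        exact (hM.le_iff.1 hle').elim (fun h => absurd h hM'.1) (fun h => h.symm)
      have := hG M hM.1
      obtain ⟨x, hxM, hxD, hxN⟩ := exists_mem_normalizer_of_lt_of_isNilpotent hlt
      have hlt3 : D < M ⊓ M₃ := lt_of_le_of_ne (le_inf hlt.le (le_normalizer.trans hle))
        fun h => hxD (h ▸ ⟨hxM, hle hxN⟩)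
      exact not_lt_bot (ih _ hlt3 hM h₃ hM3 rfl ▸ hlt3)
    exact hne ((key h₁ h₂ hne hD).trans (key h₂ h₁ hne.symm (inf_comm M₁ M₂ ▸ hD)).symm)

theorem map_conj_eq_of_isCoatom [IsSimpleGroup G]
    (hG : ∀ H : Subgroup G, H ≠ ⊤ → Group.IsNilpotent H) {M₁ M₂ : Subgroup G}
    (h₁ : IsCoatom M₁) (h₂ : IsCoatom M₂) {x g : G} (hx : x ∈ M₁) (hx1 : x ≠ 1)
    (hg : g * x * g⁻¹ ∈ M₂) : M₁.map (MulAut.conj g : G →* G) = M₂ := by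
  by_contra hne
  have : M₁.map (MulAut.conj g : G →* G) ⊓ M₂ = ⊥ :=
    inf_eq_bot_of_isCoatom hG (((MulAut.conj g).mapSubgroup.isCoatom_iff M₁).2 h₁) h₂ hne
  have hmem : g * x * g⁻¹ ∈ M₁.map (MulAut.conj g : G →* G) ⊓ M₂ := ⟨⟨x, hx, rfl⟩, hg⟩
  rw [this, mem_bot] at hmem
  exact hx1 (by simpa using hmem)

theorem conjOfCoset_injective [IsSimpleGroup G]
    (hG : ∀ H : Subgroup G, H ≠ ⊤ → Group.IsNilpotent H) {M : Subgroup G} (hM : IsCoatom M)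
    (hbot : M ≠ ⊥) : Function.Injective M.conjOfCoset := by
  rintro ⟨p, ⟨x, hx⟩⟩ ⟨q, ⟨y, hy⟩⟩ h
  have h' : p.out * x * p.out⁻¹ = q.out * y * q.out⁻¹ := congrArg Subtype.val h
  have hconj : (q.out⁻¹ * p.out) * x * (q.out⁻¹ * p.out)⁻¹ = y := by
    have : (q.out⁻¹ * p.out) * x * (q.out⁻¹ * p.out)⁻¹ =
        q.out⁻¹ * (p.out * x * p.out⁻¹) * q.out := by group
    rw [this, h']
    group
  have hmem := mem_of_map_conj_eq_of_isCoatom hM hbot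
    (map_conj_eq_of_isCoatom hG hM hM x.2 (fun h => hx (Subtype.ext h)) (hconj ▸ y.2))
  obtain rfl : q = p := by
    rw [← QuotientGroup.out_eq' q, ← QuotientGroup.out_eq' p]
    exact QuotientGroup.eq.2 hmem
  have : x = y := Subtype.ext (by simpa using h')
  subst this
  rfl

theorem card_conjOfCoset_domain (M : Subgroup G) :
    Nat.card ((G ⧸ M) × {m : M // m ≠ 1}) = Nat.card G - M.index := by
  have h1 : Nat.card {m : M // m ≠ 1} = Nat.card M - 1 := by
    classical
    have := Fintype.ofFinite M
    rw [Nat.card_eq_fintype_card, Nat.card_eq_fintype_card, Fintype.card_subtype_compl,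
      Fintype.card_subtype_eq]
  rw [Nat.card_prod, h1, ← M.card_mul_index, Nat.mul_sub_one, mul_comm (Nat.card M)]
  rfl

end Subgroup

/-- Distinct maximal subgroups intersect trivially, so a conjugacy class of maximal subgroups `M`
covers `|G| - |G : M| ≥ |G| / 2` non-identity elements, but not all of them. A second class covers
others, again `|G| / 2` of them, which is too many. -/
theorem isSolvable_of_isSimpleGroup_of_proper_isNilpotent {G : Type*} [Group G] [Finite G]
    [IsSimpleGroup G] (hG : ∀ H : Subgroup G, H ≠ ⊤ → Group.IsNilpotent H) : Group.IsSolvable G := by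
  by_contra hns
  have zpowers_ne : ∀ x : G, Subgroup.zpowers x ≠ ⊤ := fun x hx => hns <| by
    refine Group.isSolvable_of_comm fun a b => ?_
    obtain ⟨m, rfl⟩ := Subgroup.mem_zpowers_iff.1 (hx ▸ Subgroup.mem_top a)
    obtain ⟨n, rfl⟩ := Subgroup.mem_zpowers_iff.1 (hx ▸ Subgroup.mem_top b)
    exact (Commute.refl x).zpow_zpow m n
  have exists_coatom : ∀ x : G, x ≠ 1 → ∃ M : Subgroup G, IsCoatom M ∧ x ∈ M ∧ M ≠ ⊥ := by
    intro x hx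
    obtain ⟨M, hM, hle⟩ := (eq_top_or_exists_le_coatom _).resolve_left (zpowers_ne x)
    have hxM : x ∈ M := hle (Subgroup.mem_zpowers x)
    exact ⟨M, hM, hxM, fun h => hx (by simpa [h] using hxM)⟩
  have card_ne_one : Nat.card {g : G // g ≠ 1} = Nat.card G - 1 := by
    classical
    have := Fintype.ofFinite G
    rw [Nat.card_eq_fintype_card, Nat.card_eq_fintype_card, Fintype.card_subtype_compl,
      Fintype.card_subtype_eq]
  have two_mul_index : ∀ M : Subgroup G, M ≠ ⊥ → 2 * M.index ≤ Nat.card G := by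
    intro M hM
    rw [← M.card_mul_index]
    exact Nat.mul_le_mul_right _ ((Subgroup.one_lt_card_iff_ne_bot M).2 hM)
  obtain ⟨x, hx⟩ := exists_ne (1 : G)
  obtain ⟨M, hM, -, hMbot⟩ := exists_coatom x hx
  have hinj := Subgroup.conjOfCoset_injective hG hM hMbot
  have hnsurj : ¬ Function.Surjective M.conjOfCoset := by
    intro hsurj
    have h := Nat.card_congr (Equiv.ofBijective _ ⟨hinj, hsurj⟩)
    rw [Subgroup.card_conjOfCoset_domain, card_ne_one] at h
    have h1 : M.index ≠ 1 := fun h => hM.1 (Subgroup.index_eq_one.1 h)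
    have := two_mul_index M hMbot
    have : M.index ≠ 0 := Subgroup.FiniteIndex.index_ne_zero
    omega
  obtain ⟨⟨y, hy⟩, hyM⟩ : ∃ y, ∀ p, M.conjOfCoset p ≠ y := by
    simpa [Function.Surjective] using hnsurj
  obtain ⟨M', hM', hyM', hM'bot⟩ := exists_coatom y hy
  have hinj' := Subgroup.conjOfCoset_injective hG hM' hM'bot
  -- A common value of the two parametrizations would make `M'` a conjugate of `M`.
  have hdisj : ∀ p q, M.conjOfCoset p ≠ M'.conjOfCoset q := by
    rintro ⟨p, m, hm⟩ ⟨q, m', hm'⟩ h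
    have h' : p.out * m * p.out⁻¹ = q.out * m' * q.out⁻¹ := congrArg Subtype.val h
    have hconj : (q.out⁻¹ * p.out) * m * (q.out⁻¹ * p.out)⁻¹ = m' := by
      have : (q.out⁻¹ * p.out) * m * (q.out⁻¹ * p.out)⁻¹ =
          q.out⁻¹ * (p.out * m * p.out⁻¹) * q.out := by group
      rw [this, h']
      group
    have hmap := Subgroup.map_conj_eq_of_isCoatom hG hM hM' m.2 (fun h => hm (Subtype.ext h))
      (hconj ▸ m'.2)
    rw [← hmap] at hyM'
    obtain ⟨z, hz, hzy⟩ := hyM'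
    obtain ⟨k, hk⟩ := QuotientGroup.mk_out_eq_mul M (q.out⁻¹ * p.out)
    have hzy' : (q.out⁻¹ * p.out) * z * (q.out⁻¹ * p.out)⁻¹ = y := hzy
    refine hyM ⟨QuotientGroup.mk (q.out⁻¹ * p.out), ⟨k⁻¹ * ⟨z, hz⟩ * k, fun h1 => hy ?_⟩⟩
      (Subtype.ext ?_)
    · have hz1 : (⟨z, hz⟩ : M) = 1 := by
        have : (⟨z, hz⟩ : M) = k * (k⁻¹ * ⟨z, hz⟩ * k) * k⁻¹ := by group
        rw [this, h1]
        group
      rw [← hzy', show z = 1 from congrArg Subtype.val hz1]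
      group
    · simp only [Subgroup.conjOfCoset, hk, Subgroup.coe_mul, Subgroup.coe_inv]
      rw [← hzy']
      group
  have hcard := Nat.card_le_card_of_injective (Sum.elim M.conjOfCoset M'.conjOfCoset)
    (hinj.sumElim hinj' hdisj)
  rw [Nat.card_sum, Subgroup.card_conjOfCoset_domain, Subgroup.card_conjOfCoset_domain,
    card_ne_one] at hcard
  have := two_mul_index M hMbot
  have := two_mul_index M' hM'bot
  have : 0 < Nat.card G := Nat.card_pos
  omega

/-- **Schmidt's theorem**, in the form that covers nilpotent groups too. -/
theorem isSolvable_of_proper_isNilpotent (G : Type*) [Group G] [Finite G]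
    (hG : ∀ H : Subgroup G, H ≠ ⊤ → Group.IsNilpotent H) : Group.IsSolvable G := by
  obtain ⟨n, hn⟩ : ∃ n, Nat.card G = n := ⟨_, rfl⟩
  induction n using Nat.strong_induction_on generalizing G with
  | _ n ih =>
    rcases subsingleton_or_nontrivial G with _ | _
    · infer_instance
    by_cases hs : ∀ N : Subgroup G, N.Normal → N = ⊥ ∨ N = ⊤
    · have : IsSimpleGroup G := ⟨fun N hN => hs N hN⟩
      exact isSolvable_of_isSimpleGroup_of_proper_isNilpotent hG
    · push Not at hs
      obtain ⟨N, hN, hbot, htop⟩ := hs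
      have := hG N htop
      have hlt : Nat.card (G ⧸ N) < n := by
        rw [← hn, N.card_eq_card_quotient_mul_card_subgroup]
        exact lt_mul_of_one_lt_right Nat.card_pos ((Subgroup.one_lt_card_iff_ne_bot N).2 hbot)
      have := ih _ hlt (G ⧸ N) (isNilpotent_proper_of_surjective hG (QuotientGroup.mk' N)
        (QuotientGroup.mk'_surjective N)) rfl
      exact (Group.isSolvable_iff_subgroup_quotient N).2 ⟨inferInstance, this⟩

/-! ### Finiteness of soluble finitely generated minimal non-nilpotent groups -/

namespace Subgroup

variable {G : Type*} [Group G]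

/-- If `D ≠ ⊤` and no two proper subgroups above `D` generate `G`, then some member of a finite
generating set generates `G` together with `D`. -/
theorem exists_sup_zpowers_eq_top [Group.FG G] {D : Subgroup G} (hD : D ≠ ⊤)
    (h : ∀ N₁ N₂ : Subgroup G, D ≤ N₁ → D ≤ N₂ → N₁ ≠ ⊤ → N₂ ≠ ⊤ → N₁ ⊔ N₂ ≠ ⊤) :
    ∃ t : G, D ⊔ zpowers t = ⊤ := by
  classical
  by_contra! hne
  obtain ⟨S, hS⟩ := Group.FG.out (G := G)
  have key : ∀ T : Finset G, D ⊔ closure (T : Set G) ≠ ⊤ := by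
    intro T
    induction T using Finset.induction_on with
    | empty => simpa using hD
    | insert a T _ ih =>
      have := h _ _ le_sup_left le_sup_left (hne a) ih
      rwa [← sup_sup_distrib_left, zpowers_eq_closure, ← closure_union, Set.singleton_union,
        ← Finset.coe_insert] at this
  exact key S (by rw [hS, sup_top_eq])

theorem finiteIndex_of_sup_zpowers_eq_top {D : Subgroup G} [D.Normal] {t : G}
    (ht : D ⊔ zpowers t = ⊤) {q : ℤ} (hq : q ≠ 0) (htq : t ^ q ∈ D) : D.FiniteIndex := by
  have h1 : zpowers (QuotientGroup.mk' D t) = ⊤ := by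
    rw [← MonoidHom.map_zpowers, ← map_top_of_surjective _ (QuotientGroup.mk'_surjective D), ← ht,
      Subgroup.map_sup, (map_eq_bot_iff _).2 (QuotientGroup.ker_mk' D).ge, bot_sup_eq]
  have h2 : IsOfFinOrder (QuotientGroup.mk' D t) :=
    isOfFinOrder_iff_zpow_eq_one.2 ⟨q, hq, by
      rw [← map_zpow]; exact (QuotientGroup.eq_one_iff _).2 htq⟩
  have h3 : Finite (zpowers (QuotientGroup.mk' D t)) := finite_zpowers.2 h2
  rw [h1] at h3
  have : Finite (G ⧸ D) := Finite.of_equiv _ topEquiv.toEquiv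
  exact finiteIndex_of_finite_quotient

end Subgroup

/-- Nakayama's lemma over `ℤ`: if all squares are trivial or all elements are squares, then some
non-zero power annihilates the group. -/
theorem CommGroup.finite_of_fg_of_sq {B : Type*} [CommGroup B] [Group.FG B]
    (h : (∀ b : B, b ^ 2 = 1) ∨ ∀ b : B, ∃ c, c ^ 2 = b) : Finite B := by
  suffices h : ∃ n : ℤ, n ≠ 0 ∧ ∀ b : B, b ^ n = 1 by
    obtain ⟨n, hn, hb⟩ := h
    exact CommGroup.finite_of_fg_isMulTorsion B fun b =>
      isOfFinOrder_iff_zpow_eq_one.2 ⟨n, hn, hb b⟩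
  rcases h with h | h
  · exact ⟨2, by norm_num, fun b => by exact_mod_cast h b⟩
  · have : Module.Finite ℤ (Additive B) := Module.Finite.iff_addGroup_fg.2 inferInstance
    obtain ⟨r, hr, hb⟩ := Submodule.exists_sub_one_mem_and_smul_eq_zero_of_fg_of_le_smul
      (Ideal.span {(2 : ℤ)}) (⊤ : Submodule ℤ (Additive B)) Module.Finite.fg_top (by
        intro x _
        obtain ⟨c, hc⟩ := h x.toMul
        have : x = (2 : ℤ) • Additive.ofMul c := by
          rw [← ofMul_zpow, zpow_ofNat]
          exact (congrArg Additive.ofMul hc).symm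
        rw [this]
        exact Submodule.smul_mem_smul (Ideal.mem_span_singleton_self 2) trivial)
    refine ⟨r, ?_, fun b => ?_⟩
    · rintro rfl
      rw [Ideal.mem_span_singleton] at hr
      omega
    · have := hb (Additive.ofMul b) trivial
      rw [← ofMul_zpow] at this
      exact Additive.ofMul.injective this

theorem CommGroup.injective_of_surjective_of_fg {B : Type*} [CommGroup B] [Group.FG B]
    (f : B →* B) (hf : Function.Surjective f) : Function.Injective f := by
  have : Module.Finite ℤ (Additive B) := Module.Finite.iff_addGroup_fg.2 inferInstance
  exact OrzechProperty.injective_of_surjective_endomorphism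
    (f.toAdditive.toIntLinearMap : Additive B →ₗ[ℤ] Additive B) hf

namespace Subgroup

variable {G : Type*} [Group G]

/-- `b ↦ ⁅t, b⁆` as an endomorphism of an abelian normal subgroup. -/
def commutatorHom (B : Subgroup G) [B.Normal] (hB : ∀ b ∈ B, ∀ c ∈ B, b * c = c * b) (t : G) :
    B →* B where
  toFun b := ⟨⁅t, (b : G)⁆, commutator_le_right ⊤ B
    (commutator_mem_commutator (mem_top t) b.2)⟩
  map_one' := Subtype.ext (commutatorElement_one_right t)
  map_mul' b c := by
    refine Subtype.ext ?_
    have hc : ⁅t, (c : G)⁆ ∈ B :=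
      commutator_le_right ⊤ B (commutator_mem_commutator (mem_top t) c.2)
    have := hB b b.2 _ hc
    calc ⁅t, (b : G) * c⁆ = ⁅t, (b : G)⁆ * (b * ⁅t, (c : G)⁆) * (b : G)⁻¹ := by
          simp only [commutatorElement_def]; group
      _ = ⁅t, (b : G)⁆ * ⁅t, (c : G)⁆ := by rw [this]; group

/-- In a metabelian group that is cyclic modulo `B = G'`, generated by `t` modulo `B`, every element
of `B` is a commutator `⁅t, b⁆`. -/
theorem commutatorHom_surjective (B : Subgroup G) [B.Normal] (hBc : B = _root_.commutator G)
    (hB : ∀ b ∈ B, ∀ c ∈ B, b * c = c * b) {t : G} (ht : B ⊔ zpowers t = ⊤) :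
    Function.Surjective (B.commutatorHom hB t) := by
  let R : Subgroup G := (B.commutatorHom hB t).range.map B.subtype
  have mem_R : ∀ b ∈ B, ⁅t, b⁆ ∈ R := fun b hb => ⟨_, ⟨⟨b, hb⟩, rfl⟩, rfl⟩
  have R_le : R ≤ B := map_subtype_le _
  have ht_conj : ∀ s : G, Commute s t → ∀ r ∈ R, s * r * s⁻¹ ∈ R := by
    rintro s hs _ ⟨_, ⟨b, rfl⟩, rfl⟩
    have h1 : s * ⁅t, (b : G)⁆ * s⁻¹ = ⁅t, s * (b : G) * s⁻¹⁆ := by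
      rw [conjugate_commutatorElement, hs.eq, mul_inv_cancel_right]
    have := mem_R _ (Normal.conj_mem (inferInstanceAs B.Normal) (b : G) b.2 s)
    rw [← h1] at this
    exact this
  have hR : R.Normal := by
    rw [← normalizer_eq_top_iff, eq_top_iff, ← ht, sup_le_iff, zpowers_le]
    constructor
    · intro b hb
      rw [mem_normalizer_iff]
      intro h
      constructor
      · intro hh
        rw [hB b hb h (R_le hh), mul_inv_cancel_right]
        exact hh
      · intro hh
        have h2 := hB b⁻¹ (B.inv_mem hb) _ (R_le hh)
        have h3 : h = b * h * b⁻¹ := by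
          calc h = b⁻¹ * (b * h * b⁻¹) * b := by group
            _ = b * h * b⁻¹ := by rw [h2]; group
        rw [h3]
        exact hh
    · rw [mem_normalizer_iff]
      intro h
      refine ⟨ht_conj t (Commute.refl t) h, fun hh => ?_⟩
      have := ht_conj t⁻¹ (Commute.refl t).inv_left _ hh
      simpa [mul_assoc] using this
  have hle : ⁅zpowers t, B⁆ ≤ R := by
    rw [commutator_le_iff_le_comap_centralizer, zpowers_le, mem_comap, mem_centralizer_iff]
    rintro _ ⟨b, hb, rfl⟩
    have : QuotientGroup.mk' R ⁅t, b⁆ = 1 := (QuotientGroup.eq_one_iff _).2 (mem_R b hb)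
    rw [map_commutatorElement, commutatorElement_eq_one_iff_mul_comm] at this
    exact this.symm
  have hBR : B ≤ R := by
    conv_lhs => rw [hBc, _root_.commutator_def, ← ht]
    have hBB : ⁅B, B⁆ ≤ R := by
      rw [commutator_le]
      intro b hb c hc
      rw [commutatorElement_eq_one_iff_mul_comm.2 (hB b hb c hc)]
      exact R.one_mem
    have htt : ⁅zpowers t, zpowers t⁆ ≤ R := by
      rw [commutator_le]
      rintro _ ⟨m, rfl⟩ _ ⟨n, rfl⟩
      rw [commutatorElement_eq_one_iff_mul_comm.2 ((Commute.refl t).zpow_zpow m n)]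
      exact R.one_mem
    rw [sup_commutator_le_iff, commutator_comm B, sup_commutator_le_iff,
      commutator_comm (zpowers t) (B ⊔ zpowers t), sup_commutator_le_iff]
    exact ⟨⟨hBB, hle⟩, commutator_comm B (zpowers t) ▸ hle, htt⟩
  intro b
  obtain ⟨c, hc, hcb⟩ := hBR b.2
  obtain ⟨d, rfl⟩ := hc
  exact ⟨d, Subtype.ext hcb⟩

/-- As `b ↦ ⁅t, b⁆` is injective on `B`, a nilpotent subgroup containing `t` meets `B`
trivially. -/
theorem inf_eq_bot_of_commutatorHom_injective (B : Subgroup G) [B.Normal]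
    (hB : ∀ b ∈ B, ∀ c ∈ B, b * c = c * b) {t : G}
    (hinj : Function.Injective (B.commutatorHom hB t)) (H : Subgroup G) [Group.IsNilpotent H]
    (htH : t ∈ H) : H ⊓ B = ⊥ := by
  obtain ⟨c, hc⟩ := (isNilpotent_iff_lowerCentralSeries (S := H)).1 inferInstance
  rw [eq_bot_iff]
  rintro b ⟨hbH, hbB⟩
  have hmem : ∀ n, (((B.commutatorHom hB t)^[n] ⟨b, hbB⟩ : B) : G) ∈ H.lowerCentralSeries n := by
    intro n
    induction n with
    | zero => exact hbH
    | succ n ih =>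
      rw [Function.iterate_succ_apply', lowerCentralSeries_succ, commutator_comm]
      exact commutator_mem_commutator htH ih
  have h1 := hmem c
  rw [hc, mem_bot] at h1
  have h2 : (B.commutatorHom hB t)^[c] ⟨b, hbB⟩ = (B.commutatorHom hB t)^[c] 1 := by
    rw [iterate_map_one]
    exact Subtype.ext h1
  exact congrArg Subtype.val (hinj.iterate c h2)

end Subgroup

/-- A metabelian group that is cyclic modulo `B = G'` and has only nilpotent proper subgroups has a
finite derived subgroup, if the latter is finitely generated: the proper subgroups containing a
generator `t` modulo `B` meet `B` trivially, while `⟨t⟩ B²` meets `B` at least in `B²`. -/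
theorem finite_commutator_of_proper_isNilpotent {G : Type*} [Group G]
    (hG : ∀ H : Subgroup G, H ≠ ⊤ → Group.IsNilpotent H) [Group.FG (commutator G)]
    (hB : ∀ b ∈ commutator G, ∀ c ∈ commutator G, b * c = c * b) {t : G}
    (ht : commutator G ⊔ Subgroup.zpowers t = ⊤) : Finite (commutator G) := by
  let B := commutator G
  let _ : CommGroup B :=
    { (inferInstance : Group B) with mul_comm := fun a b => Subtype.ext (hB a a.2 b b.2) }
  have hinj : Function.Injective (B.commutatorHom hB t) :=
    CommGroup.injective_of_surjective_of_fg (B := B) _ (B.commutatorHom_surjective rfl hB ht)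
  have hbot : ∀ H : Subgroup G, H ≠ ⊤ → t ∈ H → H ⊓ B = ⊥ := fun H hH htH =>
    have := hG H hH
    B.inf_eq_bot_of_commutatorHom_injective hB hinj H htH
  by_cases hz : Subgroup.zpowers t = ⊤
  · have : B = ⊥ := by
      refine (commutator_eq_bot_iff G).2 ⟨⟨fun a b => ?_⟩⟩
      obtain ⟨m, rfl⟩ := Subgroup.mem_zpowers_iff.1 (hz ▸ Subgroup.mem_top a)
      obtain ⟨n, rfl⟩ := Subgroup.mem_zpowers_iff.1 (hz ▸ Subgroup.mem_top b)
      exact (Commute.refl t).zpow_zpow m n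
    change Finite B
    rw [this]
    infer_instance
  -- `⟨t⟩ B²` is either proper, and then meets `B` trivially, or everything, and then `B = B²`.
  let S : Subgroup G := (powMonoidHom (α := B) 2).range.map B.subtype
  have mem_S : ∀ c : B, (c : G) ^ 2 ∈ S := fun c => ⟨_, ⟨c, rfl⟩, rfl⟩
  have hS : S.Normal := by
    refine ⟨?_⟩
    rintro _ ⟨_, ⟨c, rfl⟩, rfl⟩ g
    have := mem_S ⟨g * c * g⁻¹, Subgroup.Normal.conj_mem inferInstance _ c.2 g⟩
    rw [conj_pow] at this
    exact this
  refine CommGroup.finite_of_fg_of_sq (B := B) ?_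
  by_cases hH : Subgroup.zpowers t ⊔ S = ⊤
  · right
    intro b
    obtain ⟨x, hx, y, hy, hxy⟩ := Subgroup.mem_sup_of_normal_right.1 (hH ▸ Subgroup.mem_top (b : G))
    have hyB : y ∈ B := Subgroup.map_subtype_le _ hy
    have hxB : x ∈ Subgroup.zpowers t ⊓ B :=
      ⟨hx, by rw [eq_mul_inv_of_mul_eq hxy]; exact B.mul_mem b.2 (B.inv_mem hyB)⟩
    rw [hbot _ hz (Subgroup.mem_zpowers t), Subgroup.mem_bot] at hxB
    obtain ⟨_, ⟨c, rfl⟩, hc⟩ := hy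
    refine ⟨c, Subtype.ext ?_⟩
    rw [← hxy, hxB, one_mul, ← hc]
    rfl
  · left
    intro b
    have := hbot _ hH (le_sup_left (a := Subgroup.zpowers t) (Subgroup.mem_zpowers t))
    have hb : (b : G) ^ 2 ∈ (Subgroup.zpowers t ⊔ S) ⊓ B :=
      ⟨le_sup_right (a := Subgroup.zpowers t) (mem_S b), B.pow_mem b.2 2⟩
    rw [this, Subgroup.mem_bot] at hb
    exact Subtype.ext hb

/-- By Fitting's theorem `X / X'` is cyclic, generated by some `t`, and finite. The derived subgroup
`X' / X''` of `X / X''` is finite by `finite_commutator_of_proper_isNilpotent`, and hence so is the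
nilpotent group `X'`. -/
theorem IsMinimalNonNilpotent.finite_of_isSolvable {X : Type*} [Group X] [Group.FG X]
    [Group.IsSolvable X] (hX : IsMinimalNonNilpotent X) : Finite X := by
  have : Nontrivial X := not_subsingleton_iff_nontrivial.1 fun _ => hX.1 inferInstance
  have hD : commutator X ≠ ⊤ := (Group.IsSolvable.commutator_lt_top_of_nontrivial X).ne
  have hsup : ∀ N₁ N₂ : Subgroup X, commutator X ≤ N₁ → commutator X ≤ N₂ → N₁ ≠ ⊤ → N₂ ≠ ⊤ →
      N₁ ⊔ N₂ ≠ ⊤ := by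
    intro N₁ N₂ hc₁ hc₂ h₁ h₂ h
    have := Subgroup.Normal.of_commutator_le X hc₁
    have := Subgroup.Normal.of_commutator_le X hc₂
    have := hX.2 N₁ h₁
    have := hX.2 N₂ h₂
    exact hX.1 (Subgroup.isNilpotent_of_sup_eq_top N₁ N₂ h)
  obtain ⟨t, ht⟩ := Subgroup.exists_sup_zpowers_eq_top hD hsup
  obtain ⟨q, hq, htq⟩ : ∃ q : ℤ, q ≠ 0 ∧ t ^ q ∈ commutator X := by
    -- As `t = t ^ 3 * (t ^ 2)⁻¹`, one of `t ^ 2` and `t ^ 3` generates `X` modulo `X'`; then `t` is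
    -- a power of it modulo `X'`.
    have hpow : ∀ n : ℕ, n ≠ 0 → n ≠ 1 → commutator X ⊔ Subgroup.zpowers (t ^ n) = ⊤ →
        ∃ q : ℤ, q ≠ 0 ∧ t ^ q ∈ commutator X := by
      intro n hn0 hn1 h
      obtain ⟨d, hd, y, hy, hdy⟩ := Subgroup.mem_sup_of_normal_left.1 (h ▸ Subgroup.mem_top t)
      obtain ⟨k, rfl⟩ := hy
      refine ⟨1 - n * k, fun h0 => ?_, ?_⟩
      · have : (n : ℤ) ∣ 1 := ⟨k, by linarith⟩
        have := Int.natCast_dvd_natCast.1 (by exact_mod_cast this : ((n : ℕ) : ℤ) ∣ ((1 : ℕ) : ℤ))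
        exact hn1 (Nat.dvd_one.1 this)
      · have : d = t ^ (1 - n * k : ℤ) := by
          rw [zpow_sub, zpow_one, zpow_mul, zpow_natCast]
          exact eq_mul_inv_of_mul_eq hdy
        exact this ▸ hd
    by_cases h2 : commutator X ⊔ Subgroup.zpowers (t ^ 2) = ⊤
    · exact hpow 2 (by norm_num) (by norm_num) h2
    by_cases h3 : commutator X ⊔ Subgroup.zpowers (t ^ 3) = ⊤
    · exact hpow 3 (by norm_num) (by norm_num) h3
    refine absurd ?_ (hsup _ _ le_sup_left le_sup_left h3 h2)
    rw [eq_top_iff, ← ht, sup_le_iff, Subgroup.zpowers_le]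
    refine ⟨le_sup_left.trans le_sup_left, ?_⟩
    have : t = t ^ 3 * (t ^ 2)⁻¹ := by group
    have h3' : t ^ 3 ∈ commutator X ⊔ Subgroup.zpowers (t ^ 3) :=
      Subgroup.mem_sup_right (Subgroup.mem_zpowers _)
    have h2' : t ^ 2 ∈ commutator X ⊔ Subgroup.zpowers (t ^ 2) :=
      Subgroup.mem_sup_right (Subgroup.mem_zpowers _)
    have h := Subgroup.mul_mem _ (Subgroup.mem_sup_left h3')
      (Subgroup.inv_mem _ (Subgroup.mem_sup_right h2'))
    rwa [← this] at h
  have hfin := Subgroup.finiteIndex_of_sup_zpowers_eq_top ht hq htq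
  let D := commutator X
  let f := QuotientGroup.mk' ⁅D, D⁆
  have hf : Function.Surjective f := QuotientGroup.mk'_surjective _
  have hcomm : commutator (X ⧸ ⁅D, D⁆) = D.map f := by
    rw [commutator_def, ← Subgroup.map_top_of_surjective f hf, ← Subgroup.map_commutator]
    rfl
  have hfg : Group.FG (commutator (X ⧸ ⁅D, D⁆)) := by
    have : Group.FG D := D.fg_of_index_ne_zero
    rw [hcomm]
    exact Group.fg_of_surjective (f.subgroupMap_surjective D)
  have hfinD : Finite (commutator (X ⧸ ⁅D, D⁆)) := by
    refine finite_commutator_of_proper_isNilpotent (t := f t)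
      (isNilpotent_proper_of_surjective hX.2 f hf) ?_ ?_
    · rw [hcomm]
      rintro _ ⟨b, hb, rfl⟩ _ ⟨c, hc, rfl⟩
      rw [← commutatorElement_eq_one_iff_mul_comm, ← map_commutatorElement]
      exact (QuotientGroup.eq_one_iff _).2 (Subgroup.commutator_mem_commutator hb hc)
    · rw [hcomm, ← MonoidHom.map_zpowers, ← Subgroup.map_sup, ht,
        Subgroup.map_top_of_surjective f hf]
  have hDfin : Finite D := by
    have := hX.2 D hD
    refine Group.IsNilpotent.finite_of_finiteIndex_commutator D ?_
    have hker : (f.subgroupMap D).ker = commutator D := by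
      refine Subgroup.map_injective D.subtype_injective ?_
      rw [Subgroup.map_subtype_commutator]
      ext x
      simp only [Subgroup.mem_map, MonoidHom.mem_ker]
      constructor
      · rintro ⟨y, hy, rfl⟩
        exact (QuotientGroup.eq_one_iff _).1 (congrArg Subtype.val hy)
      · intro hx
        exact ⟨⟨x, D.commutator_le_self hx⟩, Subtype.ext ((QuotientGroup.eq_one_iff _).2 hx), rfl⟩
    rw [hcomm] at hfinD
    rw [← hker]
    infer_instance
  exact (Subgroup.finite_iff_finite_and_finiteIndex D).2 ⟨hDfin, hfin⟩

/-- A finite quotient is soluble by Schmidt's theorem, and the kernel is nilpotent if proper. -/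
theorem IsMinimalNonNilpotent.isSolvable_of_finiteIndex {X : Type*} [Group X]
    (hX : IsMinimalNonNilpotent X) (K : Subgroup X) [K.FiniteIndex] (hK : K ≠ ⊤) :
    Group.IsSolvable X := by
  have hN : K.normalCore ≠ ⊤ := fun h => hK (top_le_iff.1 (h ▸ K.normalCore_le))
  have := hX.2 _ hN
  have := isSolvable_of_proper_isNilpotent (X ⧸ K.normalCore)
    (isNilpotent_proper_of_surjective hX.2 (QuotientGroup.mk' _) (QuotientGroup.mk'_surjective _))
  exact (Group.isSolvable_iff_subgroup_quotient K.normalCore).2 ⟨inferInstance, this⟩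

/-! ### Groups all of whose subgroups are normal -/

section Dedekind

variable {G : Type*} [Group G]

theorem commutatorElement_mem_zpowers_left (hG : ∀ H : Subgroup G, H.Normal) (x y : G) :
    ⁅x, y⁆ ∈ Subgroup.zpowers x := by
  rw [commutatorElement_def, mul_assoc, mul_assoc, ← mul_assoc y]
  exact Subgroup.mul_mem _ (Subgroup.mem_zpowers x)
    ((hG _).conj_mem _ (Subgroup.inv_mem _ (Subgroup.mem_zpowers x)) y)

theorem commutatorElement_mem_zpowers_right (hG : ∀ H : Subgroup G, H.Normal) (x y : G) :
    ⁅x, y⁆ ∈ Subgroup.zpowers y := by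
  rw [← commutatorElement_inv]
  exact Subgroup.inv_mem _ (commutatorElement_mem_zpowers_left hG y x)

/-- Conjugations act on the cyclic normal subgroup `⟨z⟩` by power maps, which commute. -/
theorem commutatorElement_mem_center (hG : ∀ H : Subgroup G, H.Normal) (x y : G) :
    ⁅x, y⁆ ∈ Subgroup.center G := by
  suffices h : ∀ x y : G, ⁅x⁻¹, y⁻¹⁆ ∈ Subgroup.center G by simpa using h x⁻¹ y⁻¹
  intro x y
  rw [Subgroup.mem_center_iff]
  intro z
  obtain ⟨a, ha⟩ := (hG _).conj_mem _ (Subgroup.mem_zpowers z) x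
  obtain ⟨b, hb⟩ := (hG _).conj_mem _ (Subgroup.mem_zpowers z) y
  have hxy : (x * y) * z * (x * y)⁻¹ = z ^ (a * b) := by
    calc (x * y) * z * (x * y)⁻¹ = x * (y * z * y⁻¹) * x⁻¹ := by group
      _ = (x * z * x⁻¹) ^ b := by rw [← hb, conj_zpow]
      _ = z ^ (a * b) := by rw [← ha, zpow_mul]
  have hyx : (y * x) * z * (y * x)⁻¹ = z ^ (a * b) := by
    calc (y * x) * z * (y * x)⁻¹ = y * (x * z * x⁻¹) * y⁻¹ := by group
      _ = (y * z * y⁻¹) ^ a := by rw [← ha, conj_zpow]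
      _ = z ^ (a * b) := by rw [← hb, mul_comm a, zpow_mul]
  calc z * ⁅x⁻¹, y⁻¹⁆ = (y * x)⁻¹ * ((y * x) * z * (y * x)⁻¹) * (x * y) := by
        rw [commutatorElement_def]; group
    _ = (y * x)⁻¹ * ((x * y) * z * (x * y)⁻¹) * (x * y) := by rw [hxy, hyx]
    _ = ⁅x⁻¹, y⁻¹⁆ * z := by rw [commutatorElement_def]; group

theorem commutatorElement_zpow_left {x y : G} (h : ⁅x, y⁆ ∈ Subgroup.center G) (n : ℤ) :
    ⁅x ^ n, y⁆ = ⁅x, y⁆ ^ n := by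
  have hc := Subgroup.mem_center_iff.1 h
  have h1 : y * x * y⁻¹ = ⁅x, y⁆⁻¹ * x := by rw [commutatorElement_def]; group
  have h2 : Commute ⁅x, y⁆⁻¹ x := (show Commute ⁅x, y⁆ x from (hc x).symm).inv_left
  have h3 : y * x ^ n * y⁻¹ = (⁅x, y⁆ ^ n)⁻¹ * x ^ n := by
    rw [← conj_zpow, h1, h2.mul_zpow, inv_zpow]
  calc ⁅x ^ n, y⁆ = x ^ n * (y * x ^ n * y⁻¹)⁻¹ := by rw [commutatorElement_def]; group
    _ = ⁅x, y⁆ ^ n := by rw [h3]; group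

theorem commutatorElement_zpow_right {x y : G} (h : ⁅x, y⁆ ∈ Subgroup.center G) (n : ℤ) :
    ⁅x, y ^ n⁆ = ⁅x, y⁆ ^ n := by
  rw [← commutatorElement_inv, commutatorElement_zpow_left, ← inv_zpow, commutatorElement_inv]
  rw [← commutatorElement_inv]
  exact Subgroup.inv_mem _ h

/-- The power formula in class two, with the correction term `d ^ (n choose 2)`. -/
theorem mul_pow_of_mul_eq_central {u v d : G} (hd : d ∈ Subgroup.center G) (h : u * v = d * v * u)
    (n : ℕ) : (v * u) ^ n = v ^ n * u ^ n * d ^ n.choose 2 := by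
  have hc := Subgroup.mem_center_iff.1 hd
  have hcpow : ∀ m : ℕ, ∀ g : G, Commute g (d ^ m) := fun m g =>
    (show Commute g d from hc g).pow_right m
  have hun : ∀ n : ℕ, u ^ n * v = d ^ n * v * u ^ n := by
    intro n
    induction n with
    | zero => simp
    | succ n ih =>
      calc u ^ (n + 1) * v = u ^ n * (u * v) := by rw [pow_succ, mul_assoc]
        _ = (u ^ n * d) * v * u := by rw [h]; group
        _ = d * (u ^ n * v) * u := by rw [hc]; group
        _ = d ^ (n + 1) * v * u ^ (n + 1) := by rw [ih, pow_succ' d, pow_succ u]; group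
  induction n with
  | zero => simp
  | succ n ih =>
    have hch : (n + 1).choose 2 = n + n.choose 2 := by
      rw [Nat.choose_succ_succ' n 1, Nat.choose_one_right]
    calc (v * u) ^ (n + 1) = v ^ n * u ^ n * (d ^ n.choose 2 * (v * u)) := by
          rw [pow_succ, ih, mul_assoc]
      _ = v ^ n * (u ^ n * v) * u * d ^ n.choose 2 := by
          rw [← (hcpow _ (v * u)).eq]; group
      _ = (v ^ n * d ^ n) * v * u ^ n * u * d ^ n.choose 2 := by rw [hun]; group
      _ = d ^ n * (v ^ n * v * (u ^ n * u)) * d ^ n.choose 2 := by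
          rw [(hcpow n (v ^ n)).eq]; group
      _ = v ^ (n + 1) * u ^ (n + 1) * d ^ (n + 1).choose 2 := by
          rw [← (hcpow n _).eq, hch, pow_add, pow_succ v, pow_succ u]; group

/-- If `⁅x, y⁆ = x ^ m`, then `⁅x, y⁆ ^ m = ⁅x ^ m, y⁆ = 1` as `⁅x, y⁆` is central. -/
theorem isOfFinOrder_of_not_commute (hG : ∀ H : Subgroup G, H.Normal) {x y : G}
    (h : ¬ Commute x y) : IsOfFinOrder x := by
  have hne : ⁅x, y⁆ ≠ 1 := fun h' => h (commutatorElement_eq_one_iff_commute.1 h')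
  obtain ⟨m, hm : x ^ m = ⁅x, y⁆⟩ := commutatorElement_mem_zpowers_left hG x y
  have hc := commutatorElement_mem_center hG x y
  have hm0 : m ≠ 0 := by
    rintro rfl
    exact hne (by rw [← hm, zpow_zero])
  have h1 : ⁅x, y⁆ ^ m = 1 := by
    rw [← commutatorElement_zpow_left hc, hm, commutatorElement_eq_one_iff_mul_comm]
    exact (Subgroup.mem_center_iff.1 hc y).symm
  rw [← hm, ← zpow_mul] at h1
  exact isOfFinOrder_iff_zpow_eq_one.2 ⟨m * m, mul_ne_zero hm0 hm0, h1⟩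

theorem exists_not_commute_of_not_mem_center {y : G} (hy : y ∉ Subgroup.center G) :
    ∃ x, ¬ Commute x y := by
  by_contra! h
  exact hy (Subgroup.mem_center_iff.2 h)

/-- If `c` has prime order `p` in the cyclic group `⟨x⟩` of order `p ^ (a + 1)`, then `c` is a
power of `x ^ p ^ a` with exponent prime to `p`. -/
theorem exists_pow_eq_of_mem_zpowers {x c : G} {p a : ℕ} (hp : p.Prime)
    (hx : orderOf x = p ^ (a + 1)) (hc : c ∈ Subgroup.zpowers x) (hc1 : c ≠ 1) (hcp : c ^ p = 1) :
    ∃ k : ℕ, ¬ p ∣ k ∧ x ^ (p ^ a * k) = c := by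
  have hfin : IsOfFinOrder x := orderOf_pos_iff.1 (hx ▸ pow_pos hp.pos _)
  obtain ⟨m, rfl⟩ := (hfin.mem_powers_iff_mem_zpowers.2 hc)
  simp only at hc1 hcp
  rw [← pow_mul, ← orderOf_dvd_iff_pow_eq_one, hx, pow_succ] at hcp
  obtain ⟨k, rfl⟩ := Nat.dvd_of_mul_dvd_mul_right hp.pos hcp
  refine ⟨k, fun ⟨j, hj⟩ => hc1 ?_, rfl⟩
  rw [← orderOf_dvd_iff_pow_eq_one, hx, hj, pow_succ, ← mul_assoc]
  exact dvd_mul_right _ _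

theorem exists_orderOf_eq_prime_pow {x c : G} {p : ℕ} (hp : p.Prime) (hx : IsOfFinOrder x)
    (hx1 : x ≠ 1) (hc : orderOf c = p)
    (h : ∀ q : ℕ, q.Prime → q ∣ orderOf x → c ^ q = 1) : ∃ a, orderOf x = p ^ (a + 1) := by
  have := Nat.eq_prime_pow_of_unique_prime_dvd (n := orderOf x) (p := p) hx.orderOf_pos.ne'
    fun {q} hq hqx => by
      have := orderOf_dvd_of_pow_eq_one (h q hq hqx)
      rw [hc] at this
      exact ((Nat.prime_dvd_prime_iff_eq hp hq).1 this).symm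
  obtain ⟨m, hm⟩ : ∃ m, orderOf x = p ^ m := ⟨_, this⟩
  cases m with
  | zero => exact absurd (orderOf_eq_one_iff.1 (by simpa using hm)) hx1
  | succ a => exact ⟨a, hm⟩

/-- Take `y` of least order outside the centre, and `x` of least order not commuting with `y`. By
minimality both are `p`-elements and `c = ⁅x, y⁆` has order `p`. If `y` had order other than `4`,
then multiplying a power of `y` by one of `x` would cancel the subgroup of order `p`, giving
a non-central element of smaller order. -/
theorem exists_not_mem_center_pow_four_eq_one (hG : ∀ H : Subgroup G, H.Normal)
    (hnc : ∃ y : G, y ∉ Subgroup.center G) : ∃ y : G, y ∉ Subgroup.center G ∧ y ^ 4 = 1 := by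
  obtain ⟨y, hy, hymin⟩ : ∃ y ∉ Subgroup.center G, ∀ z ∉ Subgroup.center G,
      orderOf y ≤ orderOf z := by
    obtain ⟨y, hy, hmin⟩ := exists_minimalFor_of_wellFoundedLT (fun y => y ∉ Subgroup.center G)
      orderOf hnc
    exact ⟨y, hy, fun z hz => (le_total _ _).elim id fun h => hmin hz h⟩
  obtain ⟨x, hxy, hxmin⟩ : ∃ x, ¬ Commute x y ∧ ∀ z, ¬ Commute z y → orderOf x ≤ orderOf z := by
    obtain ⟨x, hx, hmin⟩ := exists_minimalFor_of_wellFoundedLT (fun x => ¬ Commute x y)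
      orderOf (exists_not_commute_of_not_mem_center hy)
    exact ⟨x, hx, fun z hz => (le_total _ _).elim id fun h => hmin hz h⟩
  have hxfin := isOfFinOrder_of_not_commute hG hxy
  have hyfin := isOfFinOrder_of_not_commute hG (fun h => hxy h.symm)
  have hcen := commutatorElement_mem_center hG x y
  obtain ⟨c, hcdef⟩ : ∃ c, ⁅x, y⁆ = c := ⟨_, rfl⟩
  have hc1 : c ≠ 1 := fun h => hxy (commutatorElement_eq_one_iff_commute.1 (hcdef.trans h))
  have hzx : ∀ n : ℤ, ⁅x ^ n, y⁆ = c ^ n := fun n => by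
    rw [commutatorElement_zpow_left hcen, hcdef]
  have hzy : ∀ n : ℤ, ⁅x, y ^ n⁆ = c ^ n := fun n => by
    rw [commutatorElement_zpow_right hcen, hcdef]
  have lt_of_dvd : ∀ z : G, IsOfFinOrder z → ∀ q : ℕ, q.Prime → q ∣ orderOf z →
      orderOf (z ^ q) < orderOf z := by
    intro z hz q hq hqz
    rw [orderOf_pow_of_dvd hq.ne_zero hqz]
    exact Nat.div_lt_self hz.orderOf_pos hq.one_lt
  have hxq : ∀ q : ℕ, q.Prime → q ∣ orderOf x → c ^ q = 1 := by
    intro q hq hqx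
    have hcomm : Commute (x ^ q) y := by
      by_contra h
      exact (hxmin _ h).not_gt (lt_of_dvd x hxfin q hq hqx)
    have := hzx q
    rw [zpow_natCast, zpow_natCast, commutatorElement_eq_one_iff_commute.2 hcomm] at this
    exact this.symm
  have hyq : ∀ q : ℕ, q.Prime → q ∣ orderOf y → c ^ q = 1 := by
    intro q hq hqy
    have hcomm : y ^ q ∈ Subgroup.center G := by
      by_contra h
      exact (hymin _ h).not_gt (lt_of_dvd y hyfin q hq hqy)
    have := hzy q
    rw [zpow_natCast, zpow_natCast, commutatorElement_eq_one_iff_commute.2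
      (Subgroup.mem_center_iff.1 hcomm x)] at this
    exact this.symm
  have hx1 : x ≠ 1 := fun h => hxy (h ▸ Commute.one_left y)
  have hy1 : y ≠ 1 := fun h => hxy (h ▸ Commute.one_right x)
  obtain ⟨p, hp, hpx⟩ := Nat.exists_prime_and_dvd fun h => hx1 (orderOf_eq_one_iff.1 h)
  have := Fact.mk hp
  have hcp : c ^ p = 1 := hxq p hp hpx
  have hcord : orderOf c = p := orderOf_eq_prime hcp hc1
  obtain ⟨a, ha⟩ := exists_orderOf_eq_prime_pow hp hxfin hx1 hcord hxq
  obtain ⟨b, hb⟩ := exists_orderOf_eq_prime_pow hp hyfin hy1 hcord hyq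
  have hba : b ≤ a := by
    have : orderOf y ≤ orderOf x := hymin x fun h => hxy (Subgroup.mem_center_iff.1 h y).symm
    rw [ha, hb] at this
    have := (Nat.pow_le_pow_iff_right hp.one_lt).1 this
    omega
  obtain ⟨k, -, hk⟩ := exists_pow_eq_of_mem_zpowers hp ha
    (hcdef ▸ commutatorElement_mem_zpowers_left hG x y) hc1 hcp
  obtain ⟨l, hl, hlc⟩ := exists_pow_eq_of_mem_zpowers hp hb
    (hcdef ▸ commutatorElement_mem_zpowers_right hG x y) hc1 hcp
  -- `w = y ^ l * x ^ (-m)` is not central, and `w ^ p ^ b` is `1` up to the correction term of the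
  -- power formula in class two.
  let m : ℤ := ((p ^ (a - b) * k : ℕ) : ℤ)
  have hxm : (x ^ (-m)) ^ p ^ b = c⁻¹ := by
    rw [zpow_neg, inv_pow, zpow_natCast, ← pow_mul, ← hk]
    congr 2
    rw [mul_right_comm, ← pow_add, Nat.sub_add_cancel hba]
  have hyl : (y ^ l) ^ p ^ b = c := by rw [← pow_mul, mul_comm, hlc]
  let d : G := ⁅x ^ (-m), y ^ l⁆
  have hd : d ∈ Subgroup.center G := commutatorElement_mem_center hG _ _
  have hdp : d ^ p = 1 := by
    have h1 : d = (c ^ (-m)) ^ (l : ℤ) := by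
      change ⁅x ^ (-m), y ^ l⁆ = _
      rw [← zpow_natCast, commutatorElement_zpow_right (commutatorElement_mem_center hG _ _), hzx]
    rw [h1, ← zpow_mul, ← zpow_natCast, ← zpow_mul, mul_comm, zpow_mul, zpow_natCast, hcp, one_zpow]
  have hw : y ^ l * x ^ (-m) ∉ Subgroup.center G := by
    intro h
    have h1 : Commute x (y ^ l * x ^ (-m)) := Subgroup.mem_center_iff.1 h x
    have h2 : Commute x (y ^ l) := by
      have := h1.mul_right ((Commute.refl x).zpow_right m)
      simpa using this
    have h3 : c ^ l = 1 := by
      have := hzy l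
      rw [zpow_natCast, zpow_natCast, commutatorElement_eq_one_iff_commute.2 h2] at this
      exact this.symm
    exact hl (hcord ▸ orderOf_dvd_of_pow_eq_one h3)
  have hwpow : (y ^ l * x ^ (-m)) ^ p ^ b = d ^ (p ^ b).choose 2 := by
    rw [mul_pow_of_mul_eq_central hd (by simp only [d, commutatorElement_def]; group), hyl, hxm,
      mul_inv_cancel, one_mul]
  have hpb : p ^ b = 2 := by
    by_contra hne
    have hdvd : p ∣ (p ^ b).choose 2 := hp.dvd_choose_pow two_ne_zero (Ne.symm hne)
    obtain ⟨j, hj⟩ := hdvd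
    rw [hj, pow_mul, hdp, one_pow] at hwpow
    have h1 := orderOf_le_of_pow_eq_one (pow_pos hp.pos b) hwpow
    have h2 := hymin _ hw
    rw [hb] at h2
    have : p ^ b < p ^ (b + 1) := Nat.pow_lt_pow_right hp.one_lt (Nat.lt_succ_self b)
    omega
  have hp2 : p = 2 := (Nat.prime_dvd_prime_iff_eq hp Nat.prime_two).1
    (hpb ▸ dvd_pow_self p (by rintro rfl; simp at hpb))
  refine ⟨y, hy, ?_⟩
  rw [← orderOf_dvd_iff_pow_eq_one, hb, pow_succ, hpb, hp2]
  norm_num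

/-- The other powers of `w` are `1`, `w` and `w⁻¹`. -/
theorem eq_sq_of_mem_zpowers_of_mem_center {w c : G} (hw : w ∉ Subgroup.center G) (hw4 : w ^ 4 = 1)
    (hc : c ∈ Subgroup.zpowers w) (hcen : c ∈ Subgroup.center G) (hc1 : c ≠ 1) : c = w ^ 2 := by
  have hfin : IsOfFinOrder w := isOfFinOrder_iff_pow_eq_one.2 ⟨4, by norm_num, hw4⟩
  obtain ⟨k, rfl⟩ := hfin.mem_powers_iff_mem_zpowers.2 hc
  simp only at hcen hc1 ⊢
  rw [← Nat.div_add_mod k 4, pow_add, pow_mul, hw4, one_pow, one_mul] at hcen hc1 ⊢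
  have : k % 4 < 4 := Nat.mod_lt _ (by norm_num)
  interval_cases k % 4
  · simp at hc1
  · exact absurd (by simpa using hcen) hw
  · rfl
  · refine absurd ?_ hw
    have : w = (w ^ 3)⁻¹ := eq_inv_of_mul_eq_one_left (by rw [← pow_succ', hw4])
    rw [this]
    exact Subgroup.inv_mem _ hcen

/-- Either `g` is central, or `⟨g⟩` is finite and `G` acts on it with a kernel of finite index. -/
theorem finiteIndex_centralizer_of_forall_normal (hG : ∀ H : Subgroup G, H.Normal) (g : G) :
    (Subgroup.centralizer {g}).FiniteIndex := by
  by_cases hg : g ∈ Subgroup.center G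
  · have : Subgroup.centralizer {g} = ⊤ := by
      rw [Subgroup.centralizer_eq_top_iff_subset, Set.singleton_subset_iff]
      exact hg
    rw [this]
    infer_instance
  · obtain ⟨x, hx⟩ := exists_not_commute_of_not_mem_center hg
    have hfin := isOfFinOrder_of_not_commute hG (fun h => hx h.symm)
    have := hG (Subgroup.zpowers g)
    have : Finite (Subgroup.zpowers g) := finite_zpowers.2 hfin
    have : Finite (MulAut (Subgroup.zpowers g)) :=
      Finite.of_injective (fun e => (e : Subgroup.zpowers g → Subgroup.zpowers g))
        DFunLike.coe_injective
    have hker : (MulAut.conjNormal (H := Subgroup.zpowers g)).ker ≤ Subgroup.centralizer {g} := by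
      intro k hk
      rw [Subgroup.mem_centralizer_singleton_iff]
      have := congrArg (fun e : MulAut (Subgroup.zpowers g) =>
        ((e ⟨g, Subgroup.mem_zpowers g⟩ : Subgroup.zpowers g) : G)) (MonoidHom.mem_ker.1 hk)
      simp only [MulAut.conjNormal_apply, MulAut.one_apply] at this
      exact mul_inv_eq_iff_eq_mul.1 this
    exact Subgroup.finiteIndex_of_le hker

/-- In a Dedekind group the centre has finite index. If `x` and `y` do not commute and `y ^ 4 = 1`,
then the centralizer `C` of `x` and `y` is abelian: otherwise it contains a non-central `u` with
`u ^ 4 = 1`, and `⁅x, y⁆ = ⁅x, y * u⁆` is the square both of `y` and of `y * u`. -/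
theorem finiteIndex_center_of_forall_normal (hG : ∀ H : Subgroup G, H.Normal) :
    (Subgroup.center G).FiniteIndex := by
  by_cases hnc : ∃ y : G, y ∉ Subgroup.center G
  swap
  · push Not at hnc
    rw [(Subgroup.eq_top_iff' _).2 hnc]
    infer_instance
  obtain ⟨y, hy, hy4⟩ := exists_not_mem_center_pow_four_eq_one hG hnc
  obtain ⟨x, hxy⟩ := exists_not_commute_of_not_mem_center hy
  let C : Subgroup G := Subgroup.centralizer {x} ⊓ Subgroup.centralizer {y}
  have hCx : ∀ g ∈ C, Commute g x := fun g hg => Subgroup.mem_centralizer_singleton_iff.1 hg.1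
  have hCy : ∀ g ∈ C, Commute g y := fun g hg => Subgroup.mem_centralizer_singleton_iff.1 hg.2
  have hC : C.FiniteIndex := by
    have := finiteIndex_centralizer_of_forall_normal hG x
    have := finiteIndex_centralizer_of_forall_normal hG y
    infer_instance
  have sq_eq : ∀ w z : G, w ^ 4 = 1 → ¬ Commute z w → ⁅z, w⁆ = w ^ 2 := fun w z hw4 hzw =>
    eq_sq_of_mem_zpowers_of_mem_center (fun h => hzw (Subgroup.mem_center_iff.1 h z)) hw4
      (commutatorElement_mem_zpowers_right hG z w) (commutatorElement_mem_center hG z w)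
      fun h => hzw (commutatorElement_eq_one_iff_commute.1 h)
  have hCcomm : ∀ a ∈ C, ∀ b ∈ C, Commute a b := by
    by_contra! hne
    obtain ⟨a, ha, b, hb, hab⟩ := hne
    have hGC : ∀ H : Subgroup C, H.Normal := fun H => ⟨fun h hh g => by
      obtain ⟨k, hk, hkg⟩ := (hG (H.map C.subtype)).conj_mem h ⟨h, hh, rfl⟩ g
      exact (Subtype.ext hkg : k = g * h * g⁻¹) ▸ hk⟩
    obtain ⟨u, hu, hu4⟩ := exists_not_mem_center_pow_four_eq_one hGC
      ⟨⟨b, hb⟩, fun h => hab (congrArg Subtype.val (Subgroup.mem_center_iff.1 h ⟨a, ha⟩))⟩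
    obtain ⟨v, huv⟩ := exists_not_commute_of_not_mem_center hu
    have huy : Commute (u : G) y := hCy u u.2
    have hu4' : (u : G) ^ 4 = 1 := congrArg Subtype.val hu4
    have huv' : ¬ Commute (v : G) u := fun h => huv (Subtype.ext h)
    have hxyu : ⁅x, y * u⁆ = ⁅x, y⁆ := by
      have : (u : G) * x⁻¹ = x⁻¹ * u := (hCx u u.2).inv_right
      calc ⁅x, y * u⁆ = x * y * (u * x⁻¹) * (u : G)⁻¹ * y⁻¹ := by
            rw [commutatorElement_def]; group
        _ = ⁅x, y⁆ := by rw [this, commutatorElement_def]; group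
    have h1 := sq_eq y x hy4 hxy
    have h2 := sq_eq (y * u) x (by rw [huy.symm.mul_pow, hy4, hu4', one_mul]) fun h => hxy <| by
      rw [← commutatorElement_eq_one_iff_commute, ← hxyu, commutatorElement_eq_one_iff_commute]
      exact h
    have h3 := sq_eq u v hu4' huv'
    rw [hxyu, h1, huy.symm.mul_pow, left_eq_mul] at h2
    rw [h2] at h3
    exact huv' (commutatorElement_eq_one_iff_commute.1 h3)
  have := fun q : G ⧸ C => finiteIndex_centralizer_of_forall_normal hG q.out
  have := Subgroup.finiteIndex_iInf (f := fun q : G ⧸ C => Subgroup.centralizer {q.out}) this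
  refine Subgroup.finiteIndex_of_le
    (H := C ⊓ ⨅ q : G ⧸ C, Subgroup.centralizer {q.out}) fun z hz => ?_
  rw [Subgroup.mem_center_iff]
  intro g
  obtain ⟨k, hk⟩ := QuotientGroup.mk_out_eq_mul C g
  have h1 : Commute z (g * k) := by
    rw [← hk]
    exact Subgroup.mem_centralizer_singleton_iff.1 (Subgroup.mem_iInf.1 hz.2 _)
  have h2 : Commute z k := hCcomm z hz.1 k k.2
  have := h1.mul_right h2.inv_right
  rw [mul_inv_cancel_right] at this
  exact this.symm

theorem isSolvable_of_forall_normal (hG : ∀ H : Subgroup G, H.Normal) : Group.IsSolvable G := by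
  have hle : commutator G ≤ Subgroup.center G := by
    rw [commutator_def, Subgroup.commutator_le]
    exact fun x _ y _ => commutatorElement_mem_center hG x y
  have : Group.IsSolvable (commutator G) := Group.isSolvable_of_comm fun a b =>
    Subtype.ext ((Subgroup.mem_center_iff.1 (hle b.2) a))
  exact (Group.isSolvable_iff_subgroup_quotient (commutator G)).2 ⟨this,
    inferInstanceAs (Group.IsSolvable (Abelianization G))⟩

end Dedekind

/-! ### Para-nilpotent-Hamiltonian groups -/

section ParaNilHamiltonian


variable {G : Type*} [Group G]

/-- `H` is not nilpotent, and has the proper non-nilpotent subgroup `X`. -/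
theorem IsParaNilHamiltonian.normal_of_lt (hG : IsParaNilHamiltonian G) {X H : Subgroup G}
    (hX : ¬ Group.IsNilpotent X) (h : X < H) : H.Normal := by
  by_contra hH
  have hXH : ¬ Group.IsNilpotent (X.subgroupOf H) := fun hn => hX <|
    (Group.isNilpotent_congr (Subgroup.subgroupOfEquivOfLe h.le)).1 hn
  rcases hG.2 H hH with hn | hn
  · exact hXH inferInstance
  · exact hXH (hn.2 _ fun h' => h.not_ge (Subgroup.subgroupOf_eq_top.1 h'))

theorem IsLocallyGraded.exists_finiteIndex_of_le {M : Subgroup G} (hM : IsLocallyGraded M)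
    {X : Subgroup G} (hXM : X ≤ M) (hbot : X ≠ ⊥) (hfg : X.FG) :
    ∃ K : Subgroup X, K ≠ ⊤ ∧ K.FiniteIndex := by
  let e := Subgroup.subgroupOfEquivOfLe hXM
  have hfg' : (X.subgroupOf M).FG := by
    have := (Group.fg_iff_subgroup_fg X).2 hfg
    exact (Group.fg_iff_subgroup_fg _).1
      (Group.fg_of_surjective (f := e.symm.toMonoidHom) e.symm.surjective)
  obtain ⟨K, hK, hKfin⟩ := hM (X.subgroupOf M)
    (fun h => hbot (le_bot_iff.1 fun x hx => by
      have : (⟨x, hXM hx⟩ : M) ∈ X.subgroupOf M := hx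
      rw [h, Subgroup.mem_bot] at this
      exact congrArg Subtype.val this)) hfg'
  refine ⟨K.map e.toMonoidHom, fun h => hK ?_, ?_⟩
  · exact Subgroup.map_injective (f := e.toMonoidHom) e.injective
      (h.trans (Subgroup.map_top_of_surjective _ e.surjective).symm)
  · rw [Subgroup.finiteIndex_iff]
    exact ne_zero_of_dvd_ne_zero hKfin.index_ne_zero
      (Subgroup.index_map_dvd K (f := e.toMonoidHom) e.surjective)

/-- Were `M` infinite, each normal subgroup of finite index would generate `M` together with `X`, so
its index would be at most `|X|`. One of largest index, however, has a proper subgroup of finite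
index, as `M` is finitely generated and locally graded. -/
theorem finite_of_locallyGraded_of_finite_subgroup {M : Type*} [Group M] (hM : IsLocallyGraded M)
    (X : Subgroup M) [Finite X] (hX : ∀ H : Subgroup M, X < H → H = ⊤) : Finite M := by
  by_contra hinf
  have hXtop : X ≠ ⊤ := fun h => hinf <| by
    have : Finite (⊤ : Subgroup M) := h ▸ ‹Finite X›
    exact Finite.of_equiv _ Subgroup.topEquiv.toEquiv
  obtain ⟨g, -, hg⟩ := SetLike.exists_of_lt (lt_top_iff_ne_top.2 hXtop)
  have hfg : Group.FG M := by
    have h1 : X ⊔ Subgroup.zpowers g = ⊤ := hX _ <| lt_of_le_of_ne le_sup_left fun h =>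
      hg (h ▸ Subgroup.mem_sup_right (Subgroup.mem_zpowers g))
    have hfin : (insert g (X : Set M)).Finite := (Set.toFinite (X : Set M)).insert g
    refine Group.fg_iff.2 ⟨insert g X, ?_, hfin⟩
    rw [eq_top_iff, ← h1, sup_le_iff, Subgroup.zpowers_le]
    exact ⟨fun x hx => Subgroup.subset_closure (Set.mem_insert_of_mem g hx),
      Subgroup.subset_closure (Set.mem_insert g _)⟩
  have hbound : ∀ N : Subgroup M, N.Normal → N.FiniteIndex → N.index ≤ Nat.card X := by
    intro N _ _
    have hNX : ¬ N ≤ X := fun h => hinf <| by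
      have : Finite N := Finite.of_injective _ (Subgroup.inclusion_injective h)
      exact (Subgroup.finite_iff_finite_and_finiteIndex N).2 ⟨this, ‹_›⟩
    have hsup : X ⊔ N = ⊤ := hX _ <| lt_of_le_of_ne le_sup_left fun h =>
      hNX (h ▸ le_sup_right)
    refine Nat.card_le_card_of_surjective (fun x : X => (QuotientGroup.mk (x : M) : M ⧸ N)) ?_
    intro q
    obtain ⟨m, rfl⟩ := QuotientGroup.mk_surjective q
    obtain ⟨x, hx, n, hn, hxn⟩ := Subgroup.mem_sup_of_normal_right.1 (hsup ▸ Subgroup.mem_top m)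
    refine ⟨⟨x, hx⟩, QuotientGroup.eq.2 ?_⟩
    rw [← hxn, inv_mul_cancel_left]
    exact hn
  let S : Set ℕ := {n | ∃ N : Subgroup M, N.Normal ∧ N.FiniteIndex ∧ N.index = n}
  have hSne : S.Nonempty := ⟨_, ⊤, inferInstance, inferInstance, rfl⟩
  have hSbdd : BddAbove S := ⟨Nat.card X, by rintro _ ⟨N, h1, h2, rfl⟩; exact hbound N h1 h2⟩
  obtain ⟨N, hN, hNfin, hNS⟩ := Nat.sSup_mem hSne hSbdd
  have hNbot : N ≠ ⊥ := fun h => hinf <|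
    (Subgroup.finite_iff_finite_and_finiteIndex N).2 ⟨h ▸ inferInstance, hNfin⟩
  obtain ⟨K, hK, hKfin⟩ := hM N hNbot ((Group.fg_iff_subgroup_fg N).1 inferInstance)
  have hKN : K.map N.subtype < N := lt_of_le_of_ne (Subgroup.map_subtype_le K) fun h => hK <|
    Subgroup.map_injective N.subtype_injective (by
      rw [h, ← MonoidHom.range_eq_map, N.range_subtype])
  have hLfin : (K.map N.subtype).FiniteIndex := by
    rw [Subgroup.finiteIndex_iff, Subgroup.index_map_subtype]
    exact mul_ne_zero hKfin.index_ne_zero hNfin.index_ne_zero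
  have hlt := Subgroup.index_strictAnti (lt_of_le_of_lt (Subgroup.normalCore_le _) hKN)
  have hle := le_csSup hSbdd (show (K.map N.subtype).normalCore.index ∈ S from
    ⟨_, inferInstance, inferInstance, rfl⟩)
  omega

theorem finite_commutator_of_quotient (M : Subgroup G) [M.Normal] [Finite M]
    [Finite (commutator (G ⧸ M))] : Finite (commutator G) := by
  let f : commutator G →* G ⧸ M := (QuotientGroup.mk' M).comp (commutator G).subtype
  have hrange : f.range ≤ commutator (G ⧸ M) := by
    have hmap : (commutator G).map (QuotientGroup.mk' M) ≤ commutator (G ⧸ M) := by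
      rw [commutator_def, Subgroup.map_commutator]
      exact Subgroup.commutator_mono le_top le_top
    rintro _ ⟨g, rfl⟩
    exact hmap ⟨g, g.2, rfl⟩
  have : Finite f.range := Finite.of_injective _ (Subgroup.inclusion_injective hrange)
  have : Finite f.ker := Finite.of_injective
    (fun g : f.ker => (⟨(g : commutator G), (QuotientGroup.eq_one_iff _).1 g.2⟩ : M))
    fun a b h => Subtype.ext (Subtype.ext (congrArg (fun m : M => (m : G)) h))
  exact (Subgroup.finite_iff_finite_and_finiteIndex f.ker).2 ⟨this, inferInstance⟩

/-- The centralizer `C` of `M` is infinite, so `X ⊔ C` exceeds `X` and contains `M`. Hence `X` maps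
onto `M` modulo its centre. -/
theorem isSolvable_of_le_of_infinite [Infinite G] {X M : Subgroup G} [M.Normal] [Finite M]
    [Group.IsSolvable X] (hXM : X ≤ M) (h : ∀ H : Subgroup G, X < H → M ≤ H) :
    Group.IsSolvable M := by
  have : Finite (MulAut M) := Finite.of_injective (fun e => (e : M → M)) DFunLike.coe_injective
  let C := (MulAut.conjNormal (H := M)).ker
  have hC : ∀ c ∈ C, ∀ m ∈ M, c * m = m * c := by
    intro c hc m hm
    have := congrArg (fun e : MulAut M => ((e ⟨m, hm⟩ : M) : G)) (MonoidHom.mem_ker.1 hc)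
    simp only [MulAut.conjNormal_apply, MulAut.one_apply] at this
    exact mul_inv_eq_iff_eq_mul.1 this
  have hCX : ¬ C ≤ X := fun hle => not_finite_iff_infinite.2 ‹Infinite G› <| by
    have : Finite C := Finite.of_injective _ (Subgroup.inclusion_injective (hle.trans hXM))
    exact (Subgroup.finite_iff_finite_and_finiteIndex C).2 ⟨this, inferInstance⟩
  have hle : M ≤ X ⊔ C := h _ <| lt_of_le_of_ne le_sup_left fun h => hCX (h ▸ le_sup_right)
  let f : X →* M ⧸ Subgroup.center M :=
    (QuotientGroup.mk' (Subgroup.center M)).comp (Subgroup.inclusion hXM)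
  have hf : Function.Surjective f := by
    intro q
    obtain ⟨⟨m, hm⟩, rfl⟩ := QuotientGroup.mk_surjective q
    obtain ⟨x, hx, c, hc, hxc⟩ := Subgroup.mem_sup_of_normal_right.1 (hle hm)
    refine ⟨⟨x, hx⟩, QuotientGroup.eq.2 (Subgroup.mem_center_iff.2 fun n => Subtype.ext ?_)⟩
    have : x⁻¹ * m = c := by rw [← hxc, inv_mul_cancel_left]
    simp only [Subgroup.coe_mul, Subgroup.coe_inv, Subgroup.coe_inclusion, this]
    exact (hC c hc n n.2).symm
  have := Group.isSolvable_of_surjective hf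
  have : Group.IsSolvable (Subgroup.center M) := Group.isSolvable_of_comm fun a b =>
    Subtype.ext (Subgroup.mem_center_iff.1 b.2 a)
  exact (Group.isSolvable_iff_subgroup_quotient (Subgroup.center M)).2 ⟨this, inferInstance⟩

end ParaNilHamiltonian

theorem theorem4p6 (G : Type u) [Group G] (hG : IsParaNilHamiltonian G)
    (X : Subgroup G) (hfg : X.FG) (hX : IsMinimalNonNilpotent X)
    (hgr : IsLocallyGraded (Subgroup.normalClosure (X : Set G))) :
    Finite (commutator G) ∧ (X.Normal ∨ Infinite G → Group.IsSolvable G) := by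
  let M := Subgroup.normalClosure (X : Set G)
  have hXM : X ≤ M := Subgroup.le_normalClosure
  have hnormal : ∀ H : Subgroup G, X < H → H.Normal := fun H h => hG.normal_of_lt hX.1 h
  have hMle : ∀ H : Subgroup G, X < H → M ≤ H := fun H h =>
    have := hnormal H h
    Subgroup.normalClosure_le_normal h.le
  have hXbot : X ≠ ⊥ := by
    rintro rfl
    exact hX.1 inferInstance
  obtain ⟨K, hK, _⟩ := hgr.exists_finiteIndex_of_le hXM hXbot hfg
  have hXsol : Group.IsSolvable X := hX.isSolvable_of_finiteIndex K hK
  have hXfin : Finite X := by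
    have := (Group.fg_iff_subgroup_fg X).2 hfg
    exact hX.finite_of_isSolvable
  have hMfin : Finite M := by
    have : Finite (X.subgroupOf M) :=
      Finite.of_equiv _ (Subgroup.subgroupOfEquivOfLe hXM).symm.toEquiv
    refine finite_of_locallyGraded_of_finite_subgroup hgr (X.subgroupOf M) fun H hH => ?_
    have hlt : X < H.map M.subtype := by
      have := (Subgroup.map_lt_map_iff_of_injective M.subtype_injective).2 hH
      rwa [Subgroup.map_subgroupOf_eq_of_le hXM] at this
    refine eq_top_iff.2 fun m _ => ?_
    obtain ⟨m', hm', h⟩ := hMle _ hlt m.2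
    exact (Subtype.ext h : m' = m) ▸ hm'
  have hDedekind : ∀ H : Subgroup (G ⧸ M), H.Normal := by
    intro H
    have hle : M ≤ H.comap (QuotientGroup.mk' M) := by
      conv_lhs => rw [← QuotientGroup.ker_mk' M]
      exact Subgroup.ker_le_comap _ _
    have hcomap : (H.comap (QuotientGroup.mk' M)).Normal := by
      rcases (hXM.trans hle).eq_or_lt with h | h
      · rw [← le_antisymm hle (h ▸ hXM)]
        infer_instance
      · exact hnormal _ h
    rw [← Subgroup.map_comap_eq_self_of_surjective (QuotientGroup.mk'_surjective M) H]
    exact hcomap.map _ (QuotientGroup.mk'_surjective M)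
  have := finiteIndex_center_of_forall_normal hDedekind
  have := finite_commutatorSet_of_finiteIndex_center (G ⧸ M)
  refine ⟨finite_commutator_of_quotient M, fun h => ?_⟩
  refine (Group.isSolvable_iff_subgroup_quotient M).2
    ⟨?_, isSolvable_of_forall_normal hDedekind⟩
  rcases h with h | h
  · have hMX : M = X := Subgroup.normalClosure_eq_self X
    rw [hMX]
    exact hXsol
  · exact isSolvable_of_le_of_infinite hXM hMle
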